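/- Let $S$ be a unital inverse semigroup with unit $e$ (for each $s\in S$, $s^*$ is the unique element with $ss^*s=s$ and $s^*ss^*=s^*$), and let $A$ be a $C^*$-algebra, not necessarily unital. Let $\beta$ be an action of $S$ on $A$: for each $s\in S$ there are a closed two-sided ideal $E_s$ of $A$ and a $*$-isomorphism $\beta_s:E_{s^*}\to E_s$, with $E_e=A$ and $\beta_r\circ\beta_s=\beta_{rs}$ as partially defined maps (equal domains and equal values) for all $r,s\in S$. Let $L$ be the $*$-algebra of finite formal sums $\sum_s a_s\delta_s$ with $a_s\in E_s$, with operations extending additively $$(a_r\delta_r)(b_s\delta_s)=\beta_r(\beta_{r^*}(a_r)b_s)\,\delta_{rs},\qquad (a_s\delta_s)^*=\beta_{s^*}(a_s^*)\,\delta_{s^*}.$$ Write $r\le t$ if $r=tf$ for some idempotent $f\in S$ (then $E_r\subseteq E_t$), and let $N$ be the two-sided ideal of $L$ generated by all $a\delta_r-a\delta_t$ with $r\le t$ and $a\in E_r$. A covariant representation $(\pi,\nu,H)$ of $(A,S,\beta)$ consists of a Hilbert space $H$, a $*$-homomorphism $\pi:A\to B(H)$ and a multiplicative map $\nu$ from $S$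 to the partial isometries of $H$ such that for every $s\in S$: $\nu_s\pi(a)\nu_{s^*}=\pi(\beta_s(a))$ for all $a\in E_{s^*}$, and $\nu_s$ has initial space $\overline{\mathrm{span}}\,\pi(E_{s^*})H$ and final space $\overline{\mathrm{span}}\,\pi(E_s)H$. Put $(\pi\times\nu)\big(\sum_s a_s\delta_s\big)=\sum_s\pi(a_s)\nu_s$ on $L$. Let $\rho:L\to B(H)$ be a $*$-homomorphism, where $H$ is a Hilbert space. Then $$\rho|_N\equiv 0\iff \rho=\pi\times\nu\ \text{ for some covariant representation } (\pi,\nu,H) \text{ of } (A,S,\beta).$$ Moreover, every covariant representation $(\pi,\nu,H)$ with $\rho=\pi\times\nu$ is given by $\pi(a)=\rho(a\delta_e)$ for $a\in A$ and, for every $s\in S$ and every two-sided approximate unit $(u_\lambda)$ of $E_s$ with $\|u_\lambda\|\le 1$, $$\nu_s h=\lim_\lambda\rho(u_\lambda\delta_s)h\qquad(h\in H).$$ -/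

import Mathlib

open Filter Topology

/-- A unital inverse semigroup: a monoid in which every `s` has exactly one `s⁻¹` (written `s*` in
the literature) with `s s⁻¹ s = s` and `s⁻¹ s s⁻¹ = s⁻¹`. -/
class UnitalInverseSemigroup (S : Type*) extends Monoid S, Inv S where
  mul_inv_mul : ∀ s : S, s * s⁻¹ * s = s
  inv_mul_inv : ∀ s : S, s⁻¹ * s * s⁻¹ = s⁻¹
  inv_unique : ∀ s t : S, s * t * s = s → t * s * t = t → t = s⁻¹

namespace UnitalInverseSemigroup

variable {S : Type*} [UnitalInverseSemigroup S]

lemma inv_inv' (s : S) : (s⁻¹)⁻¹ = s :=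
  (inv_unique s⁻¹ s (inv_mul_inv s) (mul_inv_mul s)).symm

lemma inv_of_idem {f : S} (hf : f * f = f) : f⁻¹ = f :=
  (inv_unique f f (by rw [hf, hf]) (by rw [hf, hf])).symm

/-- The natural partial order: `s ≤ t` iff `s = t f` for some idempotent `f`. -/
def NatLE (s t : S) : Prop := ∃ f : S, f * f = f ∧ s = t * f

end UnitalInverseSemigroup

/-- A closed two-sided ideal of the (not necessarily unital) C⋆-algebra `A`. -/
structure ClosedIdeal (A : Type*) [NonUnitalCStarAlgebra A] extends Submodule ℂ A where
  mul_mem_left : ∀ (a : A) {x : A}, x ∈ carrier → a * x ∈ carrier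
  mul_mem_right : ∀ {x : A} (a : A), x ∈ carrier → x * a ∈ carrier
  isClosed : IsClosed carrier

namespace ClosedIdeal

variable {A : Type*} [NonUnitalCStarAlgebra A]

/-- The elements of `I` whose adjoint is in `I` form a C⋆-subalgebra. -/
def symmPart (I : ClosedIdeal A) : NonUnitalStarSubalgebra ℂ A where
  carrier := {x | x ∈ I.carrier ∧ star x ∈ I.carrier}
  add_mem' {x y} hx hy := ⟨I.add_mem' hx.1 hy.1, by
    rw [star_add]; exact I.add_mem' hx.2 hy.2⟩
  zero_mem' := ⟨I.zero_mem', by rw [star_zero]; exact I.zero_mem'⟩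
  mul_mem' {x y} hx hy := ⟨I.mul_mem_left x hy.1, by
    rw [star_mul]; exact I.mul_mem_left _ hx.2⟩
  smul_mem' c {x} hx := ⟨I.smul_mem' c hx.1, by
    rw [star_smul]; exact I.smul_mem' _ hx.2⟩
  star_mem' {x} hx := ⟨hx.2, by rw [star_star]; exact hx.1⟩

lemma isClosed_symmPart (I : ClosedIdeal A) : IsClosed (I.symmPart : Set A) :=
  I.isClosed.inter (I.isClosed.preimage continuous_star)

/-- A closed two-sided ideal of a C⋆-algebra is self-adjoint. -/
lemma star_mem (I : ClosedIdeal A) {a : A} (ha : a ∈ I.carrier) : star a ∈ I.carrier := by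
  have : IsClosed (I.symmPart : Set A) := I.isClosed_symmPart
  let _ : PartialOrder I.symmPart := CStarAlgebra.spectralOrder _
  have : StarOrderedRing I.symmPart := CStarAlgebra.spectralOrderedRing _
  have hl := CStarAlgebra.increasingApproximateUnit I.symmPart
  have hne : (CStarAlgebra.approximateUnit I.symmPart).NeBot := hl.neBot
  have hb : a * star a ∈ I.symmPart := by
    refine ⟨I.mul_mem_right _ ha, ?_⟩
    rw [star_mul, star_star]
    exact I.mul_mem_right _ ha
  have h1 : Tendsto (fun u : I.symmPart => a * star a * (u : A))
      (CStarAlgebra.approximateUnit I.symmPart) (𝓝 (a * star a)) :=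
    (continuous_subtype_val.tendsto _).comp (hl.tendsto_mul_left ⟨_, hb⟩)
  have h2 : Tendsto (fun u : I.symmPart => 2 * ‖a * star a - a * star a * (u : A)‖)
      (CStarAlgebra.approximateUnit I.symmPart) (𝓝 0) := by
    have := ((tendsto_const_nhds (x := a * star a)).sub h1).norm.const_mul 2
    simpa using this
  have h3 : Tendsto (fun u : I.symmPart => ‖star a - star a * (u : A)‖ ^ 2)
      (CStarAlgebra.approximateUnit I.symmPart) (𝓝 0) := by
    refine tendsto_of_tendsto_of_tendsto_of_le_of_le' tendsto_const_nhds h2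
      (Eventually.of_forall fun u => by positivity) ?_
    filter_upwards [hl.eventually_norm, hl.eventually_isSelfAdjoint] with u hu hsa
    have hsa' : star (u : A) = u := congrArg Subtype.val hsa.star_eq
    have hu' : ‖(u : A)‖ ≤ 1 := hu
    have key : star (star a - star a * (u : A)) * (star a - star a * (u : A))
        = (a * star a - a * star a * u) - u * (a * star a - a * star a * u) := by
      simp only [star_sub, star_mul, star_star, hsa']
      noncomm_ring
    rw [sq, ← CStarRing.norm_star_mul_self, key]
    calc _ ≤ ‖a * star a - a * star a * (u : A)‖
          + ‖(u : A)‖ * ‖a * star a - a * star a * (u : A)‖ :=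
          (norm_sub_le _ _).trans (by gcongr; exact norm_mul_le _ _)
      _ ≤ 2 * ‖a * star a - a * star a * (u : A)‖ := by
          nlinarith [norm_nonneg (a * star a - a * star a * (u : A))]
  have h4 : Tendsto (fun u : I.symmPart => ‖star a - star a * (u : A)‖)
      (CStarAlgebra.approximateUnit I.symmPart) (𝓝 0) := by
    have := h3.sqrt
    simpa [Real.sqrt_sq (norm_nonneg _)] using this
  have h5 : Tendsto (fun u : I.symmPart => star a * (u : A))
      (CStarAlgebra.approximateUnit I.symmPart) (𝓝 (star a)) := by
    rw [tendsto_iff_norm_sub_tendsto_zero]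
    simpa [norm_sub_rev] using h4
  exact I.isClosed.mem_of_tendsto h5
    (Eventually.of_forall fun u => I.mul_mem_left _ u.2.1)

/-- A closed ideal, regarded as the C⋆-algebra that it is. -/
def toStarSubalgebra (I : ClosedIdeal A) : NonUnitalStarSubalgebra ℂ A where
  toNonUnitalSubalgebra :=
    { I.toSubmodule with mul_mem' := fun {x _} _ hy => I.mul_mem_left x hy }
  star_mem' := fun ha => I.star_mem ha

end ClosedIdeal

/-- An action `β` of the unital inverse semigroup `S` on the C⋆-algebra `A`: closed ideals `E s` and
⋆-isomorphisms `β s : E s⁻¹ → E s` with `E 1 = A` and `β r ∘ β s = β (r s)` as partially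
defined maps; the two sides of the last equation have the same domain (`mem_dom_mul`) and
the same values on it (`apply_apply`). -/
structure InvAction (S A : Type*) [UnitalInverseSemigroup S] [NonUnitalCStarAlgebra A] where
  ideal : S → ClosedIdeal A
  β : ∀ s : S, (ideal s⁻¹).toStarSubalgebra ≃⋆ₐ[ℂ] (ideal s).toStarSubalgebra
  mem_one : ∀ a : A, a ∈ (ideal 1).toStarSubalgebra
  mem_dom_mul : ∀ (r s : S) (a : A), a ∈ (ideal (r * s)⁻¹).toStarSubalgebra ↔
    ∃ h : a ∈ (ideal s⁻¹).toStarSubalgebra, (β s ⟨a, h⟩ : A) ∈ (ideal r⁻¹).toStarSubalgebra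
  apply_apply : ∀ (r s : S) (a : A) (h : a ∈ (ideal s⁻¹).toStarSubalgebra)
    (h' : (β s ⟨a, h⟩ : A) ∈ (ideal r⁻¹).toStarSubalgebra)
    (h'' : a ∈ (ideal (r * s)⁻¹).toStarSubalgebra),
    (β r ⟨β s ⟨a, h⟩, h'⟩ : A) = β (r * s) ⟨a, h''⟩

namespace InvAction

open UnitalInverseSemigroup

variable {S A : Type*} [UnitalInverseSemigroup S] [NonUnitalCStarAlgebra A]

/-- The ideal `E s`, as a C⋆-algebra. -/
abbrev E (𝔅 : InvAction S A) (s : S) : NonUnitalStarSubalgebra ℂ A :=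
  (𝔅.ideal s).toStarSubalgebra

variable (𝔅 : InvAction S A)

lemma mul_mem_E (s : S) {x : A} (hx : x ∈ 𝔅.E s) (a : A) : x * a ∈ 𝔅.E s :=
  (𝔅.ideal s).mul_mem_right a hx

lemma mem_E_mul {r s : S} {y : A} (hr : y ∈ 𝔅.E r⁻¹) (hs : y ∈ 𝔅.E s) :
    (𝔅.β r ⟨y, hr⟩ : A) ∈ 𝔅.E (r * s) := by
  obtain ⟨x, hx⟩ := (𝔅.β s).surjective ⟨y, hs⟩
  have hxy : (𝔅.β s ⟨x, x.2⟩ : A) = y := congrArg Subtype.val hx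
  have h1 : (𝔅.β s ⟨x, x.2⟩ : A) ∈ 𝔅.E r⁻¹ := by rw [hxy]; exact hr
  have h2 : (x : A) ∈ 𝔅.E (r * s)⁻¹ := (𝔅.mem_dom_mul r s x).2 ⟨x.2, h1⟩
  have h3 := 𝔅.apply_apply r s x x.2 h1 h2
  have h4 : (⟨(𝔅.β s ⟨x, x.2⟩ : A), h1⟩ : 𝔅.E r⁻¹) = ⟨y, hr⟩ := Subtype.ext hxy
  rw [h4] at h3
  rw [h3]
  exact (𝔅.β (r * s) ⟨x, h2⟩).2

/-- `E (s t) ⊆ E s`. -/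
lemma E_mul_le (s t : S) {y : A} (hy : y ∈ 𝔅.E (s * t)) : y ∈ 𝔅.E s := by
  obtain ⟨x, hx⟩ := (𝔅.β (s * t)).surjective ⟨y, hy⟩
  obtain ⟨h1, h2⟩ := (𝔅.mem_dom_mul s t x).1 x.2
  have h3 := 𝔅.apply_apply s t x h1 h2 x.2
  have h4 : (𝔅.β (s * t) ⟨x, x.2⟩ : A) = y := congrArg Subtype.val hx
  rw [h4] at h3
  rw [← h3]
  exact (𝔅.β s _).2

/-- `r ≤ t` implies `E r ⊆ E t`. -/
lemma E_mono {r t : S} (h : NatLE r t) {a : A} (ha : a ∈ 𝔅.E r) : a ∈ 𝔅.E t := by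
  obtain ⟨f, -, rfl⟩ := h
  exact 𝔅.E_mul_le t f ha

/-- `β` of an idempotent is the identity. -/
lemma β_idem {f : S} (hf : f * f = f) (a : A) (ha : a ∈ 𝔅.E f⁻¹) : (𝔅.β f ⟨a, ha⟩ : A) = a := by
  have h0 : a ∈ 𝔅.E (f * f)⁻¹ := by rw [hf]; exact ha
  obtain ⟨h1, h2⟩ := (𝔅.mem_dom_mul f f a).1 h0
  have h3 := 𝔅.apply_apply f f a h1 h2 h0
  have h5 : ∀ (g : S) (_ : g = f) (hg : a ∈ 𝔅.E g⁻¹), (𝔅.β g ⟨a, hg⟩ : A) = 𝔅.β f ⟨a, ha⟩ := by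
    rintro g rfl hg; rfl
  rw [h5 _ hf h0] at h3
  have h6 := (𝔅.β f).injective (Subtype.ext h3)
  exact congrArg Subtype.val h6

/-- `β s⁻¹` is the inverse of `β s`, so that `β s⁻¹` may be written `(β s).symm` below. -/
lemma β_inv_apply (s : S) (a : A) (h : a ∈ 𝔅.E (s⁻¹)⁻¹) (h' : a ∈ 𝔅.E s) :
    (𝔅.β s⁻¹ ⟨a, h⟩ : A) = (𝔅.β s).symm ⟨a, h'⟩ := by
  have hb : (𝔅.β s⁻¹ ⟨a, h⟩ : A) ∈ 𝔅.E s⁻¹ := (𝔅.β s⁻¹ ⟨a, h⟩).2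
  have h0 : a ∈ 𝔅.E (s * s⁻¹)⁻¹ := (𝔅.mem_dom_mul s s⁻¹ a).2 ⟨h, hb⟩
  have h1 := 𝔅.apply_apply s s⁻¹ a h hb h0
  rw [𝔅.β_idem (by rw [← mul_assoc, mul_inv_mul]) a h0] at h1
  have h2 : 𝔅.β s ⟨(𝔅.β s⁻¹ ⟨a, h⟩ : A), hb⟩ = ⟨a, h'⟩ := Subtype.ext h1
  rw [← h2, StarAlgEquiv.symm_apply_apply]

open scoped DirectSum

/-- The space `L` of finite formal sums `∑ a_s δ_s` with `a_s ∈ E s`. -/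
def L (𝔅 : InvAction S A) : Type _ := ⨁ s : S, 𝔅.E s

noncomputable instance : AddCommGroup 𝔅.L := inferInstanceAs (AddCommGroup (⨁ s : S, 𝔅.E s))

noncomputable instance : Module ℂ 𝔅.L := inferInstanceAs (Module ℂ (⨁ s : S, 𝔅.E s))

open Classical in
/-- The element `a δ_s`, for `a ∈ E s`. -/
noncomputable def δ (s : S) : 𝔅.E s →ₗ[ℂ] 𝔅.L := DirectSum.lof ℂ S (fun s => 𝔅.E s) s

open Classical in
/-- The linear map on `L` that takes the values `φ s a` at `a δ_s`. -/
noncomputable def lift {M : Type*} [AddCommMonoid M] [Module ℂ M] (φ : ∀ s, 𝔅.E s →ₗ[ℂ] M) :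
    𝔅.L →ₗ[ℂ] M := DirectSum.toModule ℂ S M φ

/-- The coefficient `β_r (β_{r⁻¹} (a) b) ∈ E (r s)` of `(a δ_r) (b δ_s)`. -/
def mulCoeff (r s : S) (a : 𝔅.E r) (b : 𝔅.E s) : 𝔅.E (r * s) :=
  ⟨𝔅.β r ⟨(𝔅.β r).symm a * b, 𝔅.mul_mem_E r⁻¹ ((𝔅.β r).symm a).2 b⟩,
    𝔅.mem_E_mul _ ((𝔅.ideal s).mul_mem_left _ b.2)⟩

/-- `(a δ_r) (b δ_s)` as a bilinear function of `a ∈ E r` and `b ∈ E s`. -/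
noncomputable def mulδ (r s : S) : 𝔅.E r →ₗ[ℂ] 𝔅.E s →ₗ[ℂ] 𝔅.L :=
  LinearMap.mk₂ ℂ (fun a b => 𝔅.δ (r * s) (𝔅.mulCoeff r s a b))
    (fun a a' b => by
      rw [← map_add]; congr 1; apply Subtype.ext
      change (𝔅.β r _ : A) = (𝔅.β r _ + 𝔅.β r _ : 𝔅.E r)
      rw [← map_add]
      congr 2; apply Subtype.ext; simp [add_mul])
    (fun c a b => by
      rw [← map_smul]; congr 1; apply Subtype.ext
      change (𝔅.β r _ : A) = (c • 𝔅.β r _ : 𝔅.E r)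
      rw [← map_smul]
      congr 2; apply Subtype.ext; simp [smul_mul_assoc])
    (fun a b b' => by
      rw [← map_add]; congr 1; apply Subtype.ext
      change (𝔅.β r _ : A) = (𝔅.β r _ + 𝔅.β r _ : 𝔅.E r)
      rw [← map_add]
      congr 2; apply Subtype.ext; simp [mul_add])
    (fun c a b => by
      rw [← map_smul]; congr 1; apply Subtype.ext
      change (𝔅.β r _ : A) = (c • 𝔅.β r _ : 𝔅.E r)
      rw [← map_smul]
      congr 2; apply Subtype.ext; simp [mul_smul_comm])

/-- The multiplication of `L`: the bilinear extension of
`(a δ_r) (b δ_s) = β_r (β_{r⁻¹} (a) b) δ_{r s}`. -/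
noncomputable def mulL : 𝔅.L →ₗ[ℂ] 𝔅.L →ₗ[ℂ] 𝔅.L :=
  𝔅.lift fun r => (𝔅.lift fun s => (𝔅.mulδ r s).flip).flip

noncomputable instance : NonUnitalNonAssocRing 𝔅.L where
  __ := (inferInstance : AddCommGroup 𝔅.L)
  mul x y := 𝔅.mulL x y
  left_distrib x y z := (𝔅.mulL x).map_add y z
  right_distrib x y z := 𝔅.mulL.map_add₂ x y z
  zero_mul x := 𝔅.mulL.map_zero₂ x
  mul_zero x := (𝔅.mulL x).map_zero

/-- `(a δ_r)* = β_{r⁻¹} (a*) δ_{r⁻¹}` as an additive function of `a ∈ E r`. -/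
noncomputable def starδ (r : S) : 𝔅.E r →+ 𝔅.L :=
  AddMonoidHom.mk' (fun a => 𝔅.δ r⁻¹ ((𝔅.β r).symm (star a)))
    (fun a b => by rw [star_add, map_add, map_add])

open Classical in
/-- The involution of `L`: the additive extension of `(a δ_r)* = β_{r⁻¹} (a*) δ_{r⁻¹}`. -/
noncomputable instance : Star 𝔅.L where
  star x := DirectSum.toAddMonoid (fun r => 𝔅.starδ r) x

lemma lift_δ {M : Type*} [AddCommMonoid M] [Module ℂ M] (φ : ∀ s, 𝔅.E s →ₗ[ℂ] M)
    (s : S) (a : 𝔅.E s) : 𝔅.lift φ (𝔅.δ s a) = φ s a := by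
  classical
  exact DirectSum.toModule_lof (M := fun s => 𝔅.E s) (φ := φ) ℂ s a

lemma δ_mul_δ (r s : S) (a : 𝔅.E r) (b : 𝔅.E s) :
    𝔅.δ r a * 𝔅.δ s b = 𝔅.δ (r * s) (𝔅.mulCoeff r s a b) := by
  change 𝔅.mulL (𝔅.δ r a) (𝔅.δ s b) = _
  rw [mulL, lift_δ, LinearMap.flip_apply, lift_δ]
  rfl

lemma star_δ (r : S) (a : 𝔅.E r) : star (𝔅.δ r a) = 𝔅.δ r⁻¹ ((𝔅.β r).symm (star a)) := by
  classical
  exact DirectSum.toAddMonoid_of (fun r => 𝔅.starδ r) r a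

/-- The two-sided ideal `N` of `L` generated by the elements `a δ_r - a δ_t` with `r ≤ t` and
`a ∈ E r` (so that `a ∈ E t`). -/
noncomputable def N : TwoSidedIdeal 𝔅.L :=
  TwoSidedIdeal.span {x | ∃ (r t : S) (h : NatLE r t) (a : A) (ha : a ∈ 𝔅.E r),
    x = 𝔅.δ r ⟨a, ha⟩ - 𝔅.δ t ⟨a, 𝔅.E_mono h ha⟩}

variable {H : Type*} [NormedAddCommGroup H] [InnerProductSpace ℂ H] [CompleteSpace H]

/-- The closed linear span of the vectors `π(a) h` with `a ∈ E s` and `h ∈ H`. -/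
def essentialSpace (π : A →⋆ₙₐ[ℂ] (H →L[ℂ] H)) (s : S) : Submodule ℂ H :=
  (Submodule.span ℂ {k : H | ∃ a ∈ 𝔅.E s, ∃ h : H, k = π a h}).topologicalClosure

/-- `(π, ν, H)` is a covariant representation of `(A, S, β)`: `π` is a representation of `A` on `H`
and `ν` is a multiplicative map from `S` to the partial isometries of `H` satisfying the
covariance condition, such that `ν s` has initial space `(ker ν s)ᗮ` equal to the closed span of
`π(E s⁻¹) H` and final space `ran ν s` equal to the closed span of `π(E s) H`. -/
structure IsCovariantRep (π : A →⋆ₙₐ[ℂ] (H →L[ℂ] H)) (ν : S →ₙ* (H →L[ℂ] H)) : Prop where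
  partialIsometry : ∀ s : S, ν s * star (ν s) * ν s = ν s
  covariance : ∀ (s : S) (a : 𝔅.E s⁻¹), ν s * π (a : A) * ν s⁻¹ = π (𝔅.β s a : A)
  initialSpace : ∀ s : S, (LinearMap.ker (ν s).toLinearMap)ᗮ = 𝔅.essentialSpace π s⁻¹
  finalSpace : ∀ s : S, LinearMap.range (ν s).toLinearMap = 𝔅.essentialSpace π s

/-- The map `π × ν` on `L`, `∑ a_s δ_s ↦ ∑ π(a_s) ν_s`. -/
noncomputable def integrated (π : A →⋆ₙₐ[ℂ] (H →L[ℂ] H)) (ν : S →ₙ* (H →L[ℂ] H)) :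
    𝔅.L →ₗ[ℂ] (H →L[ℂ] H) :=
  𝔅.lift fun s =>
    { toFun := fun a => π (a : A) * ν s
      map_add' := fun a b => by rw [NonUnitalStarSubalgebra.coe_add, map_add, add_mul]
      map_smul' := fun c a => by
        rw [NonUnitalStarSubalgebra.coe_smul, map_smul, smul_mul_assoc, RingHom.id_apply] }

end InvAction

/-!
Write `π(a) = ρ(a δ₁)`. For `a, b ∈ E s⁻¹` one computes in `L`
`(β_s(a) δ_s)* (β_s(b) δ_s) = a*b δ_{s⁻¹s}`, and `s⁻¹s ≤ 1`, so if `ρ` vanishes on `N`, then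
`ρ(β_s(a) δ_s)* ρ(β_s(b) δ_s) = π(a*b)`. Hence `π(b)h ↦ ρ(β_s(b) δ_s)h` preserves inner products and
extends to a partial isometry `ν_s` that vanishes on `(π(E s⁻¹) H)ᗮ`. In `ν_{rs} = ν_r ν_s` both
sides map into the closed span of `π(E (r s)) H`, and in `ν_s* = ν_{s⁻¹}` into that of `π(E s⁻¹) H`,
so both may be checked after multiplication on the left by `π(a)` with `a` in that ideal, where they
follow from the multiplication and involution of `L`.

Conversely, in a covariant representation `π(a) ν_f = π(a)` for `f` idempotent and `a ∈ E f`, and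
moving `π(a)` past `ν_t` gives `π(a) ν_{tf} = π(a) ν_t` for `a ∈ E (t f)`.
-/

section Operators

variable {𝕜 E F ι : Type*} [RCLike 𝕜] [NormedAddCommGroup E] [NormedAddCommGroup F]

lemma tendsto_apply_of_mem_closure_span [NormedSpace 𝕜 E] [NormedSpace 𝕜 F] {l : Filter ι}
    {T : ι → E →L[𝕜] F} {S : E →L[𝕜] F} {C : ℝ} (hT : ∀ᶠ i in l, ‖T i‖ ≤ C) {D : Set E}
    (hD : ∀ x ∈ D, Tendsto (fun i => T i x) l (𝓝 (S x))) {x : E}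
    (hx : x ∈ (Submodule.span 𝕜 D).topologicalClosure) :
    Tendsto (fun i => T i x) l (𝓝 (S x)) := by
  have hspan : ∀ y ∈ Submodule.span 𝕜 D, Tendsto (fun i => T i y) l (𝓝 (S y)) := fun y hy => by
    induction hy using Submodule.span_induction with
    | mem y hy => exact hD y hy
    | zero => simpa only [map_zero] using tendsto_const_nhds
    | add y z _ _ hy hz => simpa only [map_add] using hy.add hz
    | smul c y _ hy => simpa only [map_smul] using hy.const_smul c
  have hbound : ∀ᶠ i in l, ∀ z, ‖(T i - S) z‖ ≤ (|C| + ‖S‖) * ‖z‖ := by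
    filter_upwards [hT] with i hi z
    refine (T i - S).le_of_opNorm_le ((norm_sub_le _ _).trans ?_) z
    gcongr
    exact hi.trans (le_abs_self C)
  rw [Metric.tendsto_nhds]
  intro ε hε
  set M := |C| + ‖S‖ + 1
  have hM : 0 < M := by positivity
  obtain ⟨y, hy, hxy⟩ := Metric.mem_closure_iff.1 hx (ε / (2 * M)) (by positivity)
  filter_upwards [hbound, Metric.tendsto_nhds.1 (hspan y hy) (ε / 2) (by positivity)]
    with i hi hiy
  rw [dist_eq_norm] at *
  have hsplit : T i x - S x = (T i - S) (x - y) + (T i y - S y) := by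
    simp only [sub_apply, map_sub]; abel
  calc ‖T i x - S x‖ ≤ ‖(T i - S) (x - y)‖ + ‖T i y - S y‖ := hsplit ▸ norm_add_le _ _
    _ ≤ M * ‖x - y‖ + ‖T i y - S y‖ := by
      gcongr
      exact (hi _).trans (by gcongr; exact (lt_add_one _).le)
    _ < M * (ε / (2 * M)) + ε / 2 := by gcongr
    _ = ε := by field_simp; ring

lemma mem_span_orthogonal_iff [InnerProductSpace 𝕜 E] {D : Set E} {z : E} :
    z ∈ (Submodule.span 𝕜 D)ᗮ ↔ ∀ x ∈ D, inner 𝕜 x z = 0 := by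
  rw [← Submodule.span_singleton_le_iff_mem, ← Submodule.isOrtho_iff_le, Submodule.isOrtho_comm,
    Submodule.isOrtho_span]
  simp only [Set.mem_singleton_iff, forall_eq]

lemma exists_continuousLinearMap_of_inner_eq [InnerProductSpace 𝕜 E] [InnerProductSpace 𝕜 F]
    [CompleteSpace E] [CompleteSpace F] (x : ι → E) (y : ι → F)
    (h : ∀ i j, inner 𝕜 (x i) (x j) = inner 𝕜 (y i) (y j)) :
    ∃ V : E →L[𝕜] F, (∀ i, V (x i) = y i) ∧ ∀ z, (∀ i, inner 𝕜 (x i) z = 0) → V z = 0 := by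
  let X : (ι →₀ 𝕜) →ₗ[𝕜] E := Finsupp.linearCombination 𝕜 x
  let Y : (ι →₀ 𝕜) →ₗ[𝕜] F := Finsupp.linearCombination 𝕜 y
  have hnorm (c : ι →₀ 𝕜) : ‖Y c‖ = ‖X c‖ := by
    simp only [norm_eq_sqrt_re_inner (𝕜 := 𝕜), X, Y, Finsupp.linearCombination_apply,
      Finsupp.sum_inner, Finsupp.inner_sum, inner_smul_left, inner_smul_right, h]
  let K : Submodule 𝕜 E := X.range.topologicalClosure
  let X' : (ι →₀ 𝕜) →ₗ[𝕜] K :=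
    X.codRestrict K fun c => X.range.le_topologicalClosure ⟨c, rfl⟩
  have hdense : DenseRange X' :=
    Subtype.dense_iff.2 fun z hz => by rwa [← Set.range_comp]
  have hext (c : ι →₀ 𝕜) : Y.extendOfNorm X' (X' c) = Y c :=
    Y.extendOfNorm_eq hdense ⟨1, fun c => by rw [one_mul]; exact (hnorm c).le⟩ c
  refine ⟨(Y.extendOfNorm X').comp K.orthogonalProjectionOnto, fun i => ?_, fun z hz => ?_⟩
  · have hXi : (X' (Finsupp.single i 1) : E) = x i := by simp [X', X]
    rw [ContinuousLinearMap.comp_apply, ← hXi,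
      Submodule.orthogonalProjectionOnto_mem_subspace_eq_self, hext]
    simp [Y]
  · have hzK : z ∈ Kᗮ := by
      rw [Submodule.orthogonal_closure, Finsupp.range_linearCombination,
        mem_span_orthogonal_iff]
      exact Set.forall_mem_range.2 hz
    rw [ContinuousLinearMap.comp_apply,
      Submodule.orthogonalProjectionOnto_eq_zero_iff.2 hzK, map_zero]

end Operators

namespace UnitalInverseSemigroup

variable {S : Type*} [UnitalInverseSemigroup S]

lemma mul_inv_idem (s : S) : s * s⁻¹ * (s * s⁻¹) = s * s⁻¹ := by
  rw [← mul_assoc, mul_inv_mul]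

lemma inv_mul_idem (s : S) : s⁻¹ * s * (s⁻¹ * s) = s⁻¹ * s := by
  rw [← mul_assoc, inv_mul_inv]

lemma inv_one' : (1 : S)⁻¹ = 1 := inv_of_idem (one_mul 1)

end UnitalInverseSemigroup

namespace InvAction

open UnitalInverseSemigroup

variable {S A : Type*} [UnitalInverseSemigroup S] [NonUnitalCStarAlgebra A]

section Algebra

variable (𝔅 : InvAction S A)

lemma mem_E_mul_inv {s : S} {a : A} (ha : a ∈ 𝔅.E s) : a ∈ 𝔅.E (s * s⁻¹) :=
  𝔅.E_mul_le (s * s⁻¹) s (by rwa [mul_inv_mul])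

lemma mem_E_inv_mul {s : S} {a : A} (ha : a ∈ 𝔅.E s⁻¹) : a ∈ 𝔅.E (s⁻¹ * s) := by
  simpa only [inv_inv'] using 𝔅.mem_E_mul_inv ha

lemma symm_mem_of_mem_mul {r s : S} {a : A} (h : a ∈ 𝔅.E (r * s)) (h' : a ∈ 𝔅.E r) :
    ((𝔅.β r).symm ⟨a, h'⟩ : A) ∈ 𝔅.E s := by
  obtain ⟨x, hx⟩ := (𝔅.β (r * s)).surjective ⟨a, h⟩
  obtain ⟨hxs, hxr⟩ := (𝔅.mem_dom_mul r s x).1 x.2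
  have hβ : 𝔅.β r ⟨_, hxr⟩ = ⟨a, h'⟩ :=
    Subtype.ext ((𝔅.apply_apply r s x hxs hxr x.2).trans (congrArg Subtype.val hx))
  rw [← hβ, StarAlgEquiv.symm_apply_apply]
  exact (𝔅.β s _).2

lemma β_inv_apply_β (s : S) (b : 𝔅.E s⁻¹) (h : (𝔅.β s b : A) ∈ 𝔅.E (s⁻¹)⁻¹) :
    (𝔅.β s⁻¹ ⟨𝔅.β s b, h⟩ : A) = b := by
  rw [𝔅.β_inv_apply s _ h (𝔅.β s b).2, Subtype.coe_eta, StarAlgEquiv.symm_apply_apply]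

lemma δ_congr {s t : S} (h : s = t) {a : 𝔅.E s} {b : 𝔅.E t} (hab : (a : A) = b) :
    𝔅.δ s a = 𝔅.δ t b := by
  subst h
  rw [Subtype.ext hab]

variable {𝔅} in
lemma linearMap_ext {M : Type*} [AddCommMonoid M] [Module ℂ M] {φ ψ : 𝔅.L →ₗ[ℂ] M}
    (h : ∀ s a, φ (𝔅.δ s a) = ψ (𝔅.δ s a)) : φ = ψ := by
  classical
  exact DirectSum.linearMap_ext ℂ fun s => LinearMap.ext (h s)

lemma δ_mul_δ_of_mem {r s : S} (a : 𝔅.E r) {b : A} (hr : b ∈ 𝔅.E r⁻¹) (hs : b ∈ 𝔅.E s) :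
    𝔅.δ r a * 𝔅.δ s ⟨b, hs⟩ =
      𝔅.δ (r * s) ⟨a * 𝔅.β r ⟨b, hr⟩, (𝔅.ideal _).mul_mem_left a (𝔅.mem_E_mul hr hs)⟩ := by
  have hβ : 𝔅.β r ((𝔅.β r).symm a * ⟨b, hr⟩) = a * 𝔅.β r ⟨b, hr⟩ := by
    rw [map_mul, StarAlgEquiv.apply_symm_apply]
  rw [δ_mul_δ]
  exact 𝔅.δ_congr rfl (congrArg Subtype.val hβ :)

lemma δ_one_mul_δ (s : S) (a : A) (b : 𝔅.E s) :
    𝔅.δ 1 ⟨a, 𝔅.mem_one a⟩ * 𝔅.δ s b = 𝔅.δ s ⟨a * b, (𝔅.ideal s).mul_mem_left a b.2⟩ := by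
  have hb : (b : A) ∈ 𝔅.E 1⁻¹ := by rw [inv_one']; exact 𝔅.mem_one b
  rw [𝔅.δ_mul_δ_of_mem _ hb b.2]
  exact 𝔅.δ_congr (one_mul s) (congrArg (a * ·) (𝔅.β_idem (one_mul 1) b hb))

lemma δ_mul_δ_one (s : S) (a : 𝔅.E s) (b : 𝔅.E s⁻¹) :
    𝔅.δ s a * 𝔅.δ 1 ⟨b, 𝔅.mem_one b⟩ = 𝔅.δ s (a * 𝔅.β s b) := by
  rw [𝔅.δ_mul_δ_of_mem a b.2]
  exact 𝔅.δ_congr (mul_one s) rfl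

lemma star_δ_β (s : S) (a : 𝔅.E s⁻¹) : star (𝔅.δ s (𝔅.β s a)) = 𝔅.δ s⁻¹ (star a) := by
  rw [star_δ, ← map_star, StarAlgEquiv.symm_apply_apply]

lemma star_δ_β_mul_δ_β (s : S) (a b : 𝔅.E s⁻¹) :
    star (𝔅.δ s (𝔅.β s a)) * 𝔅.δ s (𝔅.β s b) =
      𝔅.δ (s⁻¹ * s) ⟨star a * b, 𝔅.mem_E_inv_mul (star a * b).2⟩ := by
  have hb : (𝔅.β s b : A) ∈ 𝔅.E (s⁻¹)⁻¹ := by rw [inv_inv']; exact (𝔅.β s b).2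
  rw [star_δ_β, 𝔅.δ_mul_δ_of_mem _ hb (𝔅.β s b).2]
  exact 𝔅.δ_congr rfl (congrArg (star (a : A) * ·) (𝔅.β_inv_apply_β s b hb))

end Algebra

variable {𝔅 : InvAction S A}
  {H : Type*} [NormedAddCommGroup H] [InnerProductSpace ℂ H] [CompleteSpace H]

section EssentialSpace

variable (𝔅) (π : A →⋆ₙₐ[ℂ] (H →L[ℂ] H)) {s : S}

lemma isClosed_essentialSpace : IsClosed (𝔅.essentialSpace π s : Set H) :=
  Submodule.isClosed_topologicalClosure _

instance completeSpace_essentialSpace : CompleteSpace (𝔅.essentialSpace π s) :=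
  (𝔅.isClosed_essentialSpace π).completeSpace_coe

lemma apply_mem_essentialSpace {a : A} (ha : a ∈ 𝔅.E s) (h : H) :
    π a h ∈ 𝔅.essentialSpace π s :=
  Submodule.le_topologicalClosure _ (Submodule.subset_span ⟨a, ha, h, rfl⟩)

lemma essentialSpace_le {K : Submodule ℂ H} (hK : IsClosed (K : Set H))
    (h : ∀ a ∈ 𝔅.E s, ∀ k : H, π a k ∈ K) : 𝔅.essentialSpace π s ≤ K :=
  Submodule.topologicalClosure_minimal _
    (Submodule.span_le.2 (by rintro _ ⟨a, ha, k, rfl⟩; exact h a ha k)) hK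

lemma mem_essentialSpace_orthogonal {k : H} :
    k ∈ (𝔅.essentialSpace π s)ᗮ ↔ ∀ a ∈ 𝔅.E s, π a k = 0 := by
  have inner_apply (a : A) (h : H) : inner ℂ (π a h) k = inner ℂ h (π (star a) k) := by
    rw [map_star, ContinuousLinearMap.star_eq_adjoint, ContinuousLinearMap.adjoint_inner_right]
  rw [essentialSpace, Submodule.orthogonal_closure, mem_span_orthogonal_iff]
  constructor
  · refine fun hk a ha => ext_inner_left ℂ fun h => ?_
    rw [← star_star a, ← inner_apply, inner_zero_right]
    exact hk _ ⟨star a, star_mem ha, h, rfl⟩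
  · rintro hk _ ⟨a, ha, h, rfl⟩
    rw [inner_apply, hk _ (star_mem ha), inner_zero_right]

lemma apply_mem_essentialSpace_orthogonal (a : A) {k : H}
    (hk : k ∈ (𝔅.essentialSpace π s)ᗮ) : π a k ∈ (𝔅.essentialSpace π s)ᗮ := by
  rw [𝔅.mem_essentialSpace_orthogonal] at hk ⊢
  intro b hb
  rw [← mul_apply_eq_comp, ← map_mul, hk _ (𝔅.mul_mem_E s hb a)]

lemma apply_mem_of_forall_apply_π_mem {T : H →L[ℂ] H} {K : Submodule ℂ H}
    (hK : IsClosed (K : Set H)) (h : ∀ a ∈ 𝔅.E s, ∀ k, T (π a k) ∈ K)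
    (horth : ∀ k ∈ (𝔅.essentialSpace π s)ᗮ, T k = 0) (x : H) : T x ∈ K := by
  have hle : 𝔅.essentialSpace π s ≤ K.comap T.toLinearMap :=
    𝔅.essentialSpace_le π (hK.preimage T.continuous) h
  obtain ⟨p, hp, q, hq, rfl⟩ := (𝔅.essentialSpace π s).exists_add_mem_mem_orthogonal x
  rw [map_add, horth q hq, add_zero]
  exact hle hp

lemma ext_of_forall_π_mul {T T' : H →L[ℂ] H} (hT : ∀ h, T h ∈ 𝔅.essentialSpace π s)
    (hT' : ∀ h, T' h ∈ 𝔅.essentialSpace π s) (h : ∀ a ∈ 𝔅.E s, π a * T = π a * T') :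
    T = T' := by
  ext x
  rw [← sub_eq_zero, ← Submodule.mem_bot ℂ,
    ← Submodule.inf_orthogonal_eq_bot (𝔅.essentialSpace π s)]
  refine ⟨sub_mem (hT x) (hT' x), (𝔅.mem_essentialSpace_orthogonal π).2 fun a ha => ?_⟩
  rw [map_sub, sub_eq_zero]
  exact DFunLike.congr_fun (h a ha) x

lemma ext_of_forall_mul_π {T T' : H →L[ℂ] H} (h : ∀ a ∈ 𝔅.E s, T * π a = T' * π a)
    (horth : ∀ k ∈ (𝔅.essentialSpace π s)ᗮ, T k = T' k) : T = T' := by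
  ext x
  rw [← sub_eq_zero, ← sub_apply, ← Submodule.mem_bot ℂ]
  refine 𝔅.apply_mem_of_forall_apply_π_mem π (Submodule.closed_of_finiteDimensional ⊥)
    (fun a ha k => ?_) (fun k hk => sub_eq_zero.2 (horth k hk)) x
  exact sub_eq_zero.2 (DFunLike.congr_fun (h a ha) k)

open scoped CStarAlgebra in
lemma tendsto_π_apply {l : Filter (𝔅.E s)} (hl : l.IsApproximateUnit)
    (hb : ∀ᶠ u in l, ‖u‖ ≤ 1) {k : H} (hk : k ∈ 𝔅.essentialSpace π s) :
    Tendsto (fun u : 𝔅.E s => π u k) l (𝓝 k) := by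
  refine tendsto_apply_of_mem_closure_span (S := ContinuousLinearMap.id ℂ H) (C := 1)
    (hb.mono fun u hu => (NonUnitalStarAlgHom.norm_apply_le π (u : A)).trans hu) ?_ hk
  rintro _ ⟨a, ha, h, rfl⟩
  have hua : Tendsto (fun u : 𝔅.E s => (u : A) * a) l (𝓝 a) :=
    (continuous_subtype_val.tendsto _).comp (hl.tendsto_mul_right ⟨a, ha⟩)
  have hcont : Continuous fun b : A => π b h := (map_continuous π).clm_apply continuous_const
  simpa only [Function.comp_def, map_mul] using! (hcont.tendsto a).comp hua

end EssentialSpace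

section CovariantRep

variable {π : A →⋆ₙₐ[ℂ] (H →L[ℂ] H)} {ν : S →ₙ* (H →L[ℂ] H)}

lemma integrated_δ (s : S) (a : 𝔅.E s) : 𝔅.integrated π ν (𝔅.δ s a) = π a * ν s := by
  rw [integrated, lift_δ]; rfl

namespace IsCovariantRep

variable (hc : 𝔅.IsCovariantRep π ν)

include hc

lemma apply_mem (s : S) (h : H) : ν s h ∈ 𝔅.essentialSpace π s := by
  rw [← hc.finalSpace s]
  exact ⟨h, rfl⟩

lemma π_mul_idem {f : S} (hf : f * f = f) {a : A} (ha : a ∈ 𝔅.E f) : π a * ν f = π a := by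
  ext h
  have hker : ν f h - h ∈ (ν f).toLinearMap.ker := by
    rw [LinearMap.mem_ker, ContinuousLinearMap.coe_coe, map_sub, sub_eq_zero,
      ← mul_apply_eq_comp, ← map_mul, hf]
  have horth : ν f h - h ∈ (𝔅.essentialSpace π f)ᗮ := by
    have := (ν f).toLinearMap.ker.le_orthogonal_orthogonal hker
    rwa [hc.initialSpace, inv_of_idem hf] at this
  have := (𝔅.mem_essentialSpace_orthogonal π).1 horth a ha
  rwa [map_sub, sub_eq_zero] at this

lemma π_β_mul (s : S) (b : 𝔅.E s⁻¹) : π (𝔅.β s b : A) * ν s = ν s * π b := by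
  rw [← hc.covariance, mul_assoc, ← map_mul, mul_assoc,
    hc.π_mul_idem (inv_mul_idem s) (𝔅.mem_E_inv_mul b.2)]

lemma π_mul_of_natLE {r t : S} (h : NatLE r t) {a : A} (ha : a ∈ 𝔅.E r) :
    π a * ν r = π a * ν t := by
  obtain ⟨f, hf, rfl⟩ := h
  have hat := 𝔅.E_mul_le t f ha
  have hcomm : π a * ν t = ν t * π ((𝔅.β t).symm ⟨a, hat⟩ : A) := by
    rw [← hc.π_β_mul, StarAlgEquiv.apply_symm_apply]
  rw [map_mul, ← mul_assoc, hcomm, mul_assoc,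
    hc.π_mul_idem hf (𝔅.symm_mem_of_mem_mul ha hat)]

variable {ρ : 𝔅.L →⋆ₙₐ[ℂ] (H →L[ℂ] H)} (hρ : ∀ x : 𝔅.L, ρ x = 𝔅.integrated π ν x)

include hρ

lemma apply_eq_zero_of_mem_N (x : 𝔅.L) (hx : x ∈ 𝔅.N) : ρ x = 0 := by
  rw [← TwoSidedIdeal.mem_ker]
  refine TwoSidedIdeal.span_le.2 ?_ hx
  rintro _ ⟨r, t, h, a, ha, rfl⟩
  rw [SetLike.mem_coe, TwoSidedIdeal.mem_ker, map_sub, hρ, hρ, integrated_δ, integrated_δ,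
    hc.π_mul_of_natLE h ha, sub_self]

lemma π_eq (a : A) : π a = ρ (𝔅.δ 1 ⟨a, 𝔅.mem_one a⟩) := by
  rw [hρ, integrated_δ, hc.π_mul_idem (one_mul 1) (𝔅.mem_one a)]

lemma tendsto_apply (s : S) {l : Filter (𝔅.E s)} (hl : l.IsApproximateUnit)
    (hb : ∀ᶠ u in l, ‖u‖ ≤ 1) (h : H) :
    Tendsto (fun u => ρ (𝔅.δ s u) h) l (𝓝 (ν s h)) := by
  simp only [hρ, integrated_δ]
  exact 𝔅.tendsto_π_apply π hl hb (hc.apply_mem s h)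

end IsCovariantRep

end CovariantRep

section Implementer

variable (ρ : 𝔅.L →⋆ₙₐ[ℂ] (H →L[ℂ] H))

/-- The representation `a ↦ ρ(a δ₁)` of the coefficient algebra `A`. -/
noncomputable def coeffRep : A →⋆ₙₐ[ℂ] (H →L[ℂ] H) where
  toFun a := ρ (𝔅.δ 1 ⟨a, 𝔅.mem_one a⟩)
  map_smul' c a := by
    rw [MonoidHom.id_apply, ← map_smul, ← map_smul]; rfl
  map_zero' := by
    rw [← map_zero ρ, ← map_zero (𝔅.δ 1)]; rfl
  map_add' a b := by
    rw [← map_add, ← map_add]; rfl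
  map_mul' a b := by
    rw [← map_mul, δ_one_mul_δ]
  map_star' a := by
    have ha : a ∈ 𝔅.E 1⁻¹ := by rw [inv_one']; exact 𝔅.mem_one a
    have hβ : 𝔅.β 1 ⟨a, ha⟩ = ⟨a, 𝔅.mem_one a⟩ := Subtype.ext (𝔅.β_idem (one_mul 1) a ha)
    rw [← map_star, ← hβ, star_δ_β]
    exact congrArg ρ (𝔅.δ_congr inv_one' rfl).symm

lemma coeffRep_apply (a : A) : coeffRep ρ a = ρ (𝔅.δ 1 ⟨a, 𝔅.mem_one a⟩) := rfl

lemma coeffRep_mul_map_δ (a : A) {s : S} (b : 𝔅.E s) :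
    coeffRep ρ a * ρ (𝔅.δ s b) = ρ (𝔅.δ s ⟨a * b, (𝔅.ideal s).mul_mem_left a b.2⟩) := by
  rw [coeffRep_apply, ← map_mul, δ_one_mul_δ]

lemma map_δ_mul_coeffRep {s : S} (a : 𝔅.E s) (b : 𝔅.E s⁻¹) :
    ρ (𝔅.δ s a) * coeffRep ρ b = ρ (𝔅.δ s (a * 𝔅.β s b)) := by
  rw [coeffRep_apply, ← map_mul, δ_mul_δ_one]

variable {ρ} (hρ : ∀ x ∈ 𝔅.N, ρ x = 0)

include hρ

lemma map_δ_idem {f : S} (hf : f * f = f) (a : 𝔅.E f) : ρ (𝔅.δ f a) = coeffRep ρ a := by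
  rw [coeffRep_apply, ← sub_eq_zero, ← map_sub]
  exact hρ _ (TwoSidedIdeal.subset_span ⟨f, 1, ⟨f, hf, (one_mul f).symm⟩, a, a.2, rfl⟩)

lemma star_map_δ_β_mul_map_δ_β {s : S} (a b : 𝔅.E s⁻¹) :
    star (ρ (𝔅.δ s (𝔅.β s a))) * ρ (𝔅.δ s (𝔅.β s b)) = coeffRep ρ (star (a : A) * b) := by
  rw [← map_star, ← map_mul, star_δ_β_mul_δ_β, map_δ_idem hρ (inv_mul_idem s)]
  rfl

lemma map_δ_apply_eq_zero {s : S} (a : 𝔅.E s) {h : H}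
    (hh : h ∈ (𝔅.essentialSpace (coeffRep ρ) s⁻¹)ᗮ) : ρ (𝔅.δ s a) h = 0 := by
  obtain ⟨b, rfl⟩ := EquivLike.surjective (𝔅.β s) a
  rw [← inner_self_eq_zero (𝕜 := ℂ), ← ContinuousLinearMap.adjoint_inner_right,
    ← ContinuousLinearMap.star_eq_adjoint, ← mul_apply_eq_comp,
    star_map_δ_β_mul_map_δ_β hρ,
    (𝔅.mem_essentialSpace_orthogonal _).1 hh _ ((𝔅.ideal _).mul_mem_left _ b.2), inner_zero_right]

lemma exists_implementer (s : S) : ∃ V : H →L[ℂ] H,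
    (∀ b : 𝔅.E s⁻¹, V * coeffRep ρ b = ρ (𝔅.δ s (𝔅.β s b))) ∧
      ∀ h ∈ (𝔅.essentialSpace (coeffRep ρ) s⁻¹)ᗮ, V h = 0 := by
  obtain ⟨V, hV, hV'⟩ := exists_continuousLinearMap_of_inner_eq (𝕜 := ℂ)
    (fun p : 𝔅.E s⁻¹ × H => coeffRep ρ p.1 p.2) (fun p => ρ (𝔅.δ s (𝔅.β s p.1)) p.2)
    fun p q => by
      rw [← ContinuousLinearMap.adjoint_inner_right, ← ContinuousLinearMap.adjoint_inner_right,
        ← ContinuousLinearMap.star_eq_adjoint, ← ContinuousLinearMap.star_eq_adjoint,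
        ← mul_apply_eq_comp, ← mul_apply_eq_comp,
        star_map_δ_β_mul_map_δ_β hρ, ← map_star, ← map_mul]
  refine ⟨V, fun b => ContinuousLinearMap.ext fun h => hV (b, h), fun h hh => hV' h fun p => ?_⟩
  exact hh _ (𝔅.apply_mem_essentialSpace _ p.1.2 _)

/-- The partial isometry `ν_s` implementing `β s`, reconstructed from `ρ`: it is determined by
`ν_s ρ(b δ₁) = ρ(β_s(b) δ_s)` for `b ∈ E s⁻¹` and by vanishing on `(π(E s⁻¹) H)ᗮ`, where
`π(a) = ρ(a δ₁)`. -/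
noncomputable def implementer (s : S) : H →L[ℂ] H := (exists_implementer hρ s).choose

lemma implementer_mul_coeffRep {s : S} (b : 𝔅.E s⁻¹) :
    implementer hρ s * coeffRep ρ b = ρ (𝔅.δ s (𝔅.β s b)) :=
  (exists_implementer hρ s).choose_spec.1 b

lemma implementer_apply_eq_zero {s : S} {h : H}
    (hh : h ∈ (𝔅.essentialSpace (coeffRep ρ) s⁻¹)ᗮ) : implementer hρ s h = 0 :=
  (exists_implementer hρ s).choose_spec.2 h hh

lemma map_δ {s : S} (a : 𝔅.E s) : ρ (𝔅.δ s a) = coeffRep ρ a * implementer hρ s := by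
  refine 𝔅.ext_of_forall_mul_π (coeffRep ρ) (s := s⁻¹) (fun b hb => ?_) fun k hk => ?_
  · rw [map_δ_mul_coeffRep ρ a ⟨b, hb⟩, mul_assoc, implementer_mul_coeffRep hρ ⟨b, hb⟩,
      coeffRep_mul_map_δ]
    rfl
  · rw [map_δ_apply_eq_zero hρ a hk, mul_apply_eq_comp,
      implementer_apply_eq_zero hρ hk, map_zero]

lemma implementer_mul_coeffRep_eq {s : S} (b : 𝔅.E s⁻¹) :
    implementer hρ s * coeffRep ρ b = coeffRep ρ (𝔅.β s b) * implementer hρ s := by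
  rw [implementer_mul_coeffRep, map_δ hρ]

lemma implementer_apply_mem (s : S) (h : H) :
    implementer hρ s h ∈ 𝔅.essentialSpace (coeffRep ρ) s := by
  refine 𝔅.apply_mem_of_forall_apply_π_mem (coeffRep ρ) (𝔅.isClosed_essentialSpace _)
    (fun b hb k => ?_) (fun k hk => implementer_apply_eq_zero hρ hk) h
  rw [← mul_apply_eq_comp, implementer_mul_coeffRep_eq hρ ⟨b, hb⟩]
  exact 𝔅.apply_mem_essentialSpace _ (𝔅.β s _).2 _

lemma implementer_apply_mem_mul (s : S) {t : S} {k : H}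
    (hk : k ∈ 𝔅.essentialSpace (coeffRep ρ) t) :
    implementer hρ s k ∈ 𝔅.essentialSpace (coeffRep ρ) (s * t) := by
  refine 𝔅.essentialSpace_le (coeffRep ρ) (K := (𝔅.essentialSpace (coeffRep ρ) (s * t)).comap
    (implementer hρ s).toLinearMap) ((𝔅.isClosed_essentialSpace _).preimage
      (implementer hρ s).continuous) (fun a ha h => ?_) hk
  refine 𝔅.apply_mem_of_forall_apply_π_mem (coeffRep ρ) (s := s⁻¹)
    (T := implementer hρ s * coeffRep ρ a) (𝔅.isClosed_essentialSpace _)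
    (fun b hb k => ?_) (fun k hk => ?_) h
  · have hab : a * b ∈ 𝔅.E s⁻¹ := (𝔅.ideal _).mul_mem_left a hb
    rw [← mul_apply_eq_comp, mul_assoc, ← map_mul, implementer_mul_coeffRep_eq hρ ⟨_, hab⟩]
    exact 𝔅.apply_mem_essentialSpace _ (𝔅.mem_E_mul hab (𝔅.mul_mem_E t ha b)) _
  · exact implementer_apply_eq_zero hρ (𝔅.apply_mem_essentialSpace_orthogonal _ a hk)

lemma implementer_mul_map_δ {r s : S} {b : A} (hr : b ∈ 𝔅.E r⁻¹) (hs : b ∈ 𝔅.E s) :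
    implementer hρ r * ρ (𝔅.δ s ⟨b, hs⟩) =
      ρ (𝔅.δ (r * s) ⟨𝔅.β r ⟨b, hr⟩, 𝔅.mem_E_mul hr hs⟩) := by
  refine 𝔅.ext_of_forall_π_mul (coeffRep ρ) (fun h => implementer_apply_mem hρ r _)
    (fun h => ?_) fun a ha => ?_
  · rw [map_δ hρ]
    exact 𝔅.apply_mem_essentialSpace _ (𝔅.β r _).2 _
  · rw [← mul_assoc, ← map_δ hρ ⟨a, ha⟩, ← map_mul, 𝔅.δ_mul_δ_of_mem _ hr, coeffRep_mul_map_δ]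

lemma implementer_mul (r s : S) :
    implementer hρ (r * s) = implementer hρ r * implementer hρ s := by
  refine 𝔅.ext_of_forall_π_mul (coeffRep ρ) (implementer_apply_mem hρ _)
    (fun h => implementer_apply_mem_mul hρ r (implementer_apply_mem hρ s h)) fun a ha => ?_
  have har := 𝔅.E_mul_le r s ha
  let b := (𝔅.β r).symm ⟨a, har⟩
  have hβb : 𝔅.β r b = ⟨a, har⟩ := (𝔅.β r).apply_symm_apply _
  have hb : (b : A) ∈ 𝔅.E s := 𝔅.symm_mem_of_mem_mul ha har
  calc coeffRep ρ a * implementer hρ (r * s)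
    _ = ρ (𝔅.δ (r * s) ⟨a, ha⟩) := (map_δ hρ ⟨a, ha⟩).symm
    _ = implementer hρ r * ρ (𝔅.δ s ⟨b, hb⟩) := by
      rw [implementer_mul_map_δ hρ b.2]
      exact congrArg ρ (𝔅.δ_congr rfl (congrArg Subtype.val hβb.symm :))
    _ = implementer hρ r * coeffRep ρ b * implementer hρ s := by rw [map_δ hρ, mul_assoc]
    _ = coeffRep ρ a * (implementer hρ r * implementer hρ s) := by
      rw [implementer_mul_coeffRep_eq, hβb, mul_assoc]

lemma star_implementer (s : S) : star (implementer hρ s) = implementer hρ s⁻¹ := by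
  refine 𝔅.ext_of_forall_π_mul (coeffRep ρ) (fun h => ?_) (implementer_apply_mem hρ _)
    fun a ha => ?_
  · rw [← Submodule.orthogonal_orthogonal (𝔅.essentialSpace (coeffRep ρ) s⁻¹)]
    intro k hk
    rw [ContinuousLinearMap.star_eq_adjoint, ContinuousLinearMap.adjoint_inner_right,
      implementer_apply_eq_zero hρ hk, inner_zero_left]
  · calc coeffRep ρ a * star (implementer hρ s)
      _ = star (implementer hρ s * coeffRep ρ (star a)) := by
        rw [star_mul, ← map_star, star_star]
      _ = star (ρ (𝔅.δ s (𝔅.β s (star ⟨a, ha⟩)))) :=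
        congrArg star (implementer_mul_coeffRep hρ (star ⟨a, ha⟩))
      _ = ρ (𝔅.δ s⁻¹ ⟨a, ha⟩) := by rw [← map_star, star_δ_β, star_star]
      _ = coeffRep ρ a * implementer hρ s⁻¹ := map_δ hρ _

lemma implementer_apply_of_idem {f : S} (hf : f * f = f) {k : H}
    (hk : k ∈ 𝔅.essentialSpace (coeffRep ρ) f) : implementer hρ f k = k := by
  refine 𝔅.essentialSpace_le (coeffRep ρ)
    (K := (implementer hρ f).toLinearMap.eqLocus LinearMap.id)
    (isClosed_eq (implementer hρ f).continuous continuous_id) (fun a ha h => ?_) hk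
  have ha' : a ∈ 𝔅.E f⁻¹ := by rwa [inv_of_idem hf]
  have h1 : implementer hρ f * coeffRep ρ a = coeffRep ρ a := by
    rw [implementer_mul_coeffRep hρ ⟨a, ha'⟩, map_δ_idem hρ hf, 𝔅.β_idem hf]
  exact DFunLike.congr_fun h1 h

lemma range_implementer (s : S) :
    (implementer hρ s).toLinearMap.range = 𝔅.essentialSpace (coeffRep ρ) s := by
  refine le_antisymm (LinearMap.range_le_iff_comap.2 ?_) fun k hk => ?_
  · exact eq_top_iff.2 fun h _ => implementer_apply_mem hρ s h
  have hk' : k ∈ 𝔅.essentialSpace (coeffRep ρ) (s * s⁻¹) :=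
    𝔅.essentialSpace_le (coeffRep ρ) (𝔅.isClosed_essentialSpace _)
      (fun a ha h => 𝔅.apply_mem_essentialSpace _ (𝔅.mem_E_mul_inv ha) h) hk
  refine ⟨implementer hρ s⁻¹ k, ?_⟩
  rw [ContinuousLinearMap.coe_coe, ← mul_apply_eq_comp, ← implementer_mul,
    implementer_apply_of_idem hρ (mul_inv_idem s) hk']

/-- The multiplicative map `s ↦ ν_s` of the covariant representation reconstructed from `ρ`. -/
noncomputable def implementerHom : S →ₙ* (H →L[ℂ] H) where
  toFun := implementer hρ
  map_mul' := implementer_mul hρ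

lemma implementerHom_apply (s : S) : implementerHom hρ s = implementer hρ s := rfl

lemma isCovariantRep_implementerHom : 𝔅.IsCovariantRep (coeffRep ρ) (implementerHom hρ) where
  partialIsometry s := by
    rw [implementerHom_apply, star_implementer, ← implementer_mul, ← implementer_mul,
      mul_inv_mul]
  covariance s a := by
    rw [implementerHom_apply, implementerHom_apply, implementer_mul_coeffRep_eq, mul_assoc,
      ← implementer_mul, ← map_δ hρ ⟨_, 𝔅.mem_E_mul_inv (𝔅.β s a).2⟩,
      map_δ_idem hρ (mul_inv_idem s)]
  initialSpace s := by
    rw [implementerHom_apply, ContinuousLinearMap.orthogonal_ker,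
      ← ContinuousLinearMap.star_eq_adjoint, star_implementer, range_implementer]
    exact (𝔅.isClosed_essentialSpace _).submodule_topologicalClosure_eq
  finalSpace := range_implementer hρ

lemma map_eq_integrated (x : 𝔅.L) :
    ρ x = 𝔅.integrated (coeffRep ρ) (implementerHom hρ) x := by
  have heq : (ρ : 𝔅.L →ₗ[ℂ] (H →L[ℂ] H)) = 𝔅.integrated (coeffRep ρ) (implementerHom hρ) :=
    linearMap_ext fun s a => by rw [integrated_δ]; exact map_δ hρ a
  exact DFunLike.congr_fun heq x

end Implementer

end InvAction

/-- `ρ` is a ⋆-representation of `L` on the Hilbert space `H`. The first conjunct is the equivalence.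
The others say that a covariant representation with `ρ = π × ν` is given by `π(a) = ρ(a δ_e)` and
`ν_s = lim ρ(u δ_s)` strongly, along every (contractive) approximate unit of `E_s`. -/
theorem theorem5p6 {S A H : Type*} [UnitalInverseSemigroup S] [NonUnitalCStarAlgebra A]
    [NormedAddCommGroup H] [InnerProductSpace ℂ H] [CompleteSpace H]
    (𝔅 : InvAction S A) (ρ : 𝔅.L →⋆ₙₐ[ℂ] (H →L[ℂ] H)) :
    ((∀ x ∈ 𝔅.N, ρ x = 0) ↔
      ∃ (π : A →⋆ₙₐ[ℂ] (H →L[ℂ] H)) (ν : S →ₙ* (H →L[ℂ] H)),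
        𝔅.IsCovariantRep π ν ∧ ∀ x : 𝔅.L, ρ x = 𝔅.integrated π ν x) ∧
    ∀ (π : A →⋆ₙₐ[ℂ] (H →L[ℂ] H)) (ν : S →ₙ* (H →L[ℂ] H)),
      𝔅.IsCovariantRep π ν → (∀ x : 𝔅.L, ρ x = 𝔅.integrated π ν x) →
        (∀ a : A, π a = ρ (𝔅.δ 1 ⟨a, 𝔅.mem_one a⟩)) ∧
        ∀ (s : S) (l : Filter (𝔅.E s)), l.IsApproximateUnit → (∀ᶠ u in l, ‖u‖ ≤ 1) →
          ∀ h : H, Tendsto (fun u => ρ (𝔅.δ s u) h) l (𝓝 (ν s h)) := by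
  refine ⟨⟨fun hρ => ?_, fun ⟨π, ν, hc, hρ⟩ => hc.apply_eq_zero_of_mem_N hρ⟩,
    fun π ν hc hρ => ⟨hc.π_eq hρ, fun s l hl hb h => hc.tendsto_apply hρ s hl hb h⟩⟩
  exact ⟨InvAction.coeffRep ρ, InvAction.implementerHom hρ,
    InvAction.isCovariantRep_implementerHom hρ, InvAction.map_eq_integrated hρ⟩
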